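/- Let $T$ be the binary rooted tree, whose vertices are the finite words over $\{0,1\}$ (the root is the empty word, the level of a vertex is the length of the word), and let $\mathrm{Aut}(T)$ be its group of automorphisms. Let $a\in\mathrm{Aut}(T)$ be the automorphism that changes the first letter of every nonempty word. For a sequence $\omega=(\omega_1,\omega_2,\dots)$ in $\{0,1,2\}$, let $b_\omega,c_\omega,d_\omega\in\mathrm{Aut}(T)$ be the automorphisms that fix every vertex $1^n$ and $1^n0$ ($n\ge 0$) and whose section at $1^n0$ is trivial if $\omega_{n+1}=2$ (respectively $\omega_{n+1}=1$, $\omega_{n+1}=0$) and equal to $a$ otherwise. The Grigorchuk group of $\omega$ is $G_\omega=\langle a,b_\omega,c_\omega,d_\omega\rangle\le\mathrm{Aut}(T)$. For $G\le\mathrm{Aut}(T)$ and $n\ge 0$ let $\mathrm{St}_G(n)$ be the subgroup of all elements of $G$ that fix every vertex of level $n$. For a vertex $u$ let $\mathrm{Rist}_G(u)$ be the subgroup of all elements of $G$ that fix every vertex that does not have $u$ as a prefix, and let $\mathrm{Rist}_G(n)$ be the product of the (commuting) subgroups $\mathrm{Rist}_G(u)$ over all vertices $u$ of level $n$. The group $G$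 is a branch group if it acts transitively on every level of $T$ and $\mathrm{Rist}_G(n)$ has finite index in $G$ for every $n$. It has the congruence subgroup property if every subgroup of finite index in $G$ contains $\mathrm{St}_G(n)$ for some $n$. A group is just infinite if it is infinite and all its nontrivial normal subgroups have finite index. Theorem. For every sequence $\omega$ in $\{0,1,2\}$, the group $G_\omega$ is a branch group if and only if $\omega$ is not eventually constant. If $G_\omega$ is a branch group, then $G_\omega$ has the congruence subgroup property and $G_\omega$ is just infinite. -/

import Mathlib

namespace Grigorchuk

/-- The automorphism group of the binary rooted tree. The vertices are the finite words over the
alphabet `{0, 1}` (`false` is the letter `0`, `true` is the letter `1`), the root is the empty word,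
the level of a vertex is the length of the word, and a vertex `u` lies on the path from the root
to `v` iff `u` is a prefix of `v`. Automorphisms of the rooted tree are the bijections that
preserve this relation. They are composed as functions, `(f * g) v = f (g v)`. -/
abbrev TreeAut : Type :=
  (fun u v : List Bool => u <+: v) ≃r (fun u v : List Bool => u <+: v)

/-- The map `xw ↦ x̄w`, which swaps the two subtrees below the root. -/
def aFun : List Bool → List Bool
  | [] => []
  | x :: w => (!x) :: w

theorem aFun_invol (v : List Bool) : aFun (aFun v) = v := by
  cases v <;> simp [aFun]

theorem aFun_prefix {u v : List Bool} (h : u <+: v) : aFun u <+: aFun v := by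
  obtain ⟨t, rfl⟩ := h
  cases u with
  | nil => exact List.nil_prefix
  | cons x u => simp [aFun]

/-- The directed map with directed path `111…`, for the letter `k`: with `1ⁿ` denoting the word
`1⋯1` of length `n`, its section at `1ⁿ0` is trivial if `ω n = k` and equals `a` otherwise. -/
def dirFun (k : Fin 3) : (ℕ → Fin 3) → List Bool → List Bool
  | _, [] => []
  | ω, false :: w => false :: (if ω 0 = k then w else aFun w)
  | ω, true :: w => true :: dirFun k (fun n => ω (n + 1)) w

theorem dirFun_invol (k : Fin 3) (ω : ℕ → Fin 3) (v : List Bool) :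
    dirFun k ω (dirFun k ω v) = v := by
  induction v generalizing ω with
  | nil => rfl
  | cons x w ih =>
    cases x with
    | false => by_cases h : ω 0 = k <;> simp [dirFun, h, aFun_invol]
    | true => simp [dirFun, ih]

theorem dirFun_prefix (k : Fin 3) (ω : ℕ → Fin 3) {u v : List Bool} (h : u <+: v) :
    dirFun k ω u <+: dirFun k ω v := by
  induction u generalizing ω v with
  | nil => simp [dirFun]
  | cons x u ih =>
    obtain ⟨t, rfl⟩ := h
    cases x with
    | false =>
      by_cases h : ω 0 = k
      · simp [dirFun, h]
      · simpa [dirFun, h] using aFun_prefix (List.prefix_append u t)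
    | true => simpa [dirFun] using ih _ (List.prefix_append u t)

/-- A prefix-preserving involution of the set of vertices, as a tree automorphism. -/
def ofInvol (f : List Bool → List Bool) (hf : ∀ v, f (f v) = v)
    (hp : ∀ {u v : List Bool}, u <+: v → f u <+: f v) : TreeAut where
  toFun := f
  invFun := f
  left_inv := hf
  right_inv := hf
  map_rel_iff' := by
    intro u v
    refine ⟨fun h => ?_, fun h => hp h⟩
    have h' := hp h
    simpa [hf] using h'

/-- The rooted automorphism `a`. -/
def a : TreeAut := ofInvol aFun aFun_invol aFun_prefix

/-- The directed automorphism for the letter `k`. -/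
def dir (k : Fin 3) (ω : ℕ → Fin 3) : TreeAut :=
  ofInvol (dirFun k ω) (dirFun_invol k ω) (dirFun_prefix k ω)

/-- The generator `b_ω`. -/
def b (ω : ℕ → Fin 3) : TreeAut := dir 2 ω

/-- The generator `c_ω`. -/
def c (ω : ℕ → Fin 3) : TreeAut := dir 1 ω

/-- The generator `d_ω`. -/
def d (ω : ℕ → Fin 3) : TreeAut := dir 0 ω

/-- The Grigorchuk group `G_ω`. The sequence is indexed from `0` here, so that `ω n` is the
`(n + 1)`-st term of the sequence. -/
def G (ω : ℕ → Fin 3) : Subgroup TreeAut := Subgroup.closure {a, b ω, c ω, d ω}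

/-- The pointwise stabiliser in `H` of a set of vertices. -/
def pointStab (H : Subgroup TreeAut) (S : Set (List Bool)) : Subgroup H where
  carrier := {g | ∀ v ∈ S, (g : TreeAut) v = v}
  one_mem' := fun _ _ => rfl
  mul_mem' := by
    intro g h hg hh v hv
    change (g : TreeAut) ((h : TreeAut) v) = v
    rw [hh v hv, hg v hv]
  inv_mem' := by
    intro g hg v hv
    change (g : TreeAut).symm v = v
    exact (RelIso.symm_apply_eq _).2 (hg v hv).symm

/-- The `n`-th level stabiliser `St_H(n)`. -/
def levelStab (H : Subgroup TreeAut) (n : ℕ) : Subgroup H :=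
  pointStab H {v | v.length = n}

/-- The rigid vertex stabiliser `Rist_H(u)`: the elements of `H` that fix all vertices which do
not succeed `u`. -/
def rist (H : Subgroup TreeAut) (u : List Bool) : Subgroup H :=
  pointStab H {v | ¬ u <+: v}

/-- The rigid level stabiliser `Rist_H(n)`: the (internal direct) product of the rigid vertex
stabilisers of the vertices at level `n`. -/
def ristLevel (H : Subgroup TreeAut) (n : ℕ) : Subgroup H :=
  ⨆ u : {u : List Bool // u.length = n}, rist H u

/-- `H` acts transitively on each level of the tree. -/
def IsLevelTransitive (H : Subgroup TreeAut) : Prop :=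
  ∀ u v : List Bool, u.length = v.length → ∃ g ∈ H, g u = v

/-- `H` is a branch group. -/
def IsBranch (H : Subgroup TreeAut) : Prop :=
  IsLevelTransitive H ∧ ∀ n : ℕ, (ristLevel H n).FiniteIndex

/-- `H` has the congruence subgroup property: each subgroup of finite index contains
some level stabiliser. -/
def HasCSP (H : Subgroup TreeAut) : Prop :=
  ∀ K : Subgroup H, K.FiniteIndex → ∃ n : ℕ, levelStab H n ≤ K

/-- A group is just infinite if it is infinite and all its nontrivial normal subgroups have finite
index (equivalently, all its proper quotients are finite). -/
def IsJustInfinite (Γ : Type*) [Group Γ] : Prop :=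
  Infinite Γ ∧ ∀ N : Subgroup Γ, N.Normal → N ≠ ⊥ → N.FiniteIndex

end Grigorchuk

/-!
The groups `G ω` form a self-similar family: an element of `G ω` that fixes the first level acts on
the two subtrees by elements of `G (shift 1 ω)`, and every element of `G (shift 1 ω)` occurs as
such a section (`exists_pair_of_mem`, `exists_pair_mem`). The proof rests on the normal closures
`M ω l` of `⁅a, dir l ω⁆` in `G ω`.

* *Branching.* Whatever `l` is, `M ω l` contains a copy of `M (shift 1 ω) (ω 0)` below each vertex
  of the first level (`put_single_mem_M`). Hence `G ω` contains a copy of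
  `M (shift (n + 1) ω) (ω n)` below each vertex of level `n + 1` (`put_mem_G`).
* *Congruence.* If `ω` is not eventually constant, `M ω l` contains a level stabiliser of `G ω`
  (`exists_levelFix_le_M`). Modulo the elements whose sections lie in the normal closure of
  `dir (ω 0) (shift 1 ω)`, the group `G ω` is dihedral, and the signs of the actions on finitely many
  levels determine the relevant cosets.
* *Commutators.* If `ω 0 ≠ l`, the commutator subgroup of `M ω l` contains a copy of
  `M (shift 3 ω) (ω 2)` below the vertices of the third level (`put_mem_of_commutator_M`). This is a
  computation with a few explicit commutators and needs no hypothesis on `ω` beyond `ω 0 ≠ l`.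

Let `ω` be not eventually constant, and let a nontrivial normal subgroup contain an element moving
the vertex `v`. The double commutator trick of `put_commutator_mem` shows that it contains the
commutators of the elements of `G ω` supported below `v`. A descendant of `v` is moved as well, so
`v` may be chosen at a level `n + 1` with `ω (n + 1) ≠ ω n`. The three facts together then show
that the normal subgroup contains a level stabiliser (`exists_levelFix_le_of_normalizes`). This
gives just infiniteness and the congruence subgroup property; the first two facts show that `G ω`
is a branch group.

If `ω` is constant from the position `n` on, then `G (shift n ω)` is an infinite dihedral group,
in which only the identity is supported below a vertex of the first level. So the rigid stabilisers
of the vertices of level `n + 1` in `G ω` are trivial (`eq_one_of_fix`), and they do not generate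
a subgroup of finite index of the infinite group `G ω`.
-/

namespace Grigorchuk

open scoped commutatorElement

/-! ### Automorphisms of the two subtrees below the root -/

/-- The map underlying `pair g h`. -/
def pairFun (g h : List Bool → List Bool) : List Bool → List Bool
  | [] => []
  | false :: w => false :: g w
  | true :: w => true :: h w

/-- The automorphism that fixes the first letter and acts as `g` on the subtree below `0` and as
`h` on the subtree below `1`. -/
def pair (g h : TreeAut) : TreeAut where
  toFun := pairFun g h
  invFun := pairFun g.symm h.symm
  left_inv := by
    rintro (_ | ⟨_ | _, w⟩) <;> simp [pairFun]
  right_inv := by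
    rintro (_ | ⟨_ | _, w⟩) <;> simp [pairFun]
  map_rel_iff' := by
    rintro (_ | ⟨_ | _, u⟩) (_ | ⟨_ | _, v⟩) <;>
      simp [pairFun, List.cons_prefix_cons, g.map_rel_iff, h.map_rel_iff]

@[simp] theorem pair_false (g h : TreeAut) (w : List Bool) :
    pair g h (false :: w) = false :: g w := rfl
@[simp] theorem pair_true (g h : TreeAut) (w : List Bool) :
    pair g h (true :: w) = true :: h w := rfl
@[simp] theorem a_cons (x : Bool) (w : List Bool) : a (x :: w) = (!x) :: w := rfl

@[simp] theorem pair_mul (g h g' h' : TreeAut) :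
    pair g h * pair g' h' = pair (g * g') (h * h') := by
  ext1 v
  rcases v with _ | ⟨_ | _, w⟩ <;> rfl

@[simp] theorem pair_mul_assoc (g h g' h' z : TreeAut) :
    pair g h * (pair g' h' * z) = pair (g * g') (h * h') * z := by
  rw [← mul_assoc, pair_mul]

@[simp] theorem pair_one_one : pair 1 1 = 1 := by
  ext1 v
  rcases v with _ | ⟨_ | _, w⟩ <;> rfl

@[simp] theorem pair_inv (g h : TreeAut) : (pair g h)⁻¹ = pair g⁻¹ h⁻¹ := by
  rw [inv_eq_iff_mul_eq_one]; simp

theorem pair_pow (g h : TreeAut) (n : ℕ) : pair g h ^ n = pair (g ^ n) (h ^ n) := by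
  induction n with
  | zero => simp
  | succ n ih => simp [pow_succ, ih]

theorem pair_zpow (g h : TreeAut) (n : ℤ) : pair g h ^ n = pair (g ^ n) (h ^ n) := by
  cases n with
  | ofNat n => simp [pair_pow]
  | negSucc n => simp [zpow_negSucc, pair_pow]

theorem pair_inj {g h g' h' : TreeAut} : pair g h = pair g' h' ↔ g = g' ∧ h = h' := by
  refine ⟨fun e => ⟨?_, ?_⟩, fun e => by rw [e.1, e.2]⟩ <;> ext1 w
  · simpa using DFunLike.congr_fun e (false :: w)
  · simpa using DFunLike.congr_fun e (true :: w)

@[simp] theorem a_mul_a : a * a = 1 := by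
  ext1 v
  exact aFun_invol v

@[simp] theorem a_mul_a_mul (z : TreeAut) : a * (a * z) = z := by
  rw [← mul_assoc, a_mul_a, one_mul]

@[simp] theorem a_inv : a⁻¹ = a := by
  rw [inv_eq_iff_mul_eq_one, a_mul_a]

@[simp] theorem pair_mul_a (g h : TreeAut) : pair g h * a = a * pair h g := by
  ext1 v
  rcases v with _ | ⟨_ | _, w⟩ <;> rfl

@[simp] theorem pair_mul_a_mul (g h z : TreeAut) : pair g h * (a * z) = a * (pair h g * z) := by
  rw [← mul_assoc, pair_mul_a, mul_assoc]

theorem a_mul_pair_ne (g h g' h' : TreeAut) : a * pair g h ≠ pair g' h' := by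
  intro e
  simpa using DFunLike.congr_fun e [false]

theorem a_ne_pair (g h : TreeAut) : a ≠ pair g h := by
  simpa using a_mul_pair_ne 1 1 g h

/-! ### The directed generators -/

/-- The sequence `ω` without its first `n` terms. -/
def shift (n : ℕ) (ω : ℕ → Fin 3) : ℕ → Fin 3 := fun m => ω (m + n)

@[simp] theorem shift_apply (n m : ℕ) (ω : ℕ → Fin 3) : shift n ω m = ω (m + n) := rfl

theorem shift_shift_one (n : ℕ) (ω : ℕ → Fin 3) : shift n (shift 1 ω) = shift (n + 1) ω := rfl

theorem dir_eq (k : Fin 3) (ω : ℕ → Fin 3) :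
    dir k ω = pair (if ω 0 = k then 1 else a) (dir k (shift 1 ω)) := by
  ext1 v
  rcases v with _ | ⟨_ | _, w⟩
  · rfl
  · by_cases h : ω 0 = k
    · simp only [h, if_true]
      change dirFun k ω (false :: w) = _
      simp [dirFun, h]
    · simp only [h, if_false]
      change dirFun k ω (false :: w) = _
      simp only [dirFun, h, if_false]
      rfl
  · rfl

theorem dir_eq_of_eq {k : Fin 3} {ω : ℕ → Fin 3} (h : ω 0 = k) :
    dir k ω = pair 1 (dir k (shift 1 ω)) := by
  rw [dir_eq, if_pos h]

theorem dir_eq_of_ne {k : Fin 3} {ω : ℕ → Fin 3} (h : ω 0 ≠ k) :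
    dir k ω = pair a (dir k (shift 1 ω)) := by
  rw [dir_eq, if_neg h]

@[simp] theorem dir_mul_self (k : Fin 3) (ω : ℕ → Fin 3) : dir k ω * dir k ω = 1 := by
  ext1 v
  exact dirFun_invol k ω v

@[simp] theorem dir_mul_self_mul (k : Fin 3) (ω : ℕ → Fin 3) (z : TreeAut) :
    dir k ω * (dir k ω * z) = z := by
  rw [← mul_assoc, dir_mul_self, one_mul]

@[simp] theorem dir_inv (k : Fin 3) (ω : ℕ → Fin 3) : (dir k ω)⁻¹ = dir k ω := by
  rw [inv_eq_iff_mul_eq_one, dir_mul_self]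

theorem dir_mul_dir {i j k : Fin 3} (hij : i ≠ j) (hik : i ≠ k) (hjk : j ≠ k) (ω : ℕ → Fin 3) :
    dir i ω * dir j ω = dir k ω := by
  ext1 v
  change dirFun i ω (dirFun j ω v) = dirFun k ω v
  induction v generalizing ω with
  | nil => rfl
  | cons x w ih =>
    cases x with
    | true => simp [dirFun, ih]
    | false =>
      have h : ω 0 = i ∨ ω 0 = j ∨ ω 0 = k := by omega
      rcases h with h | h | h <;>
        simp [dirFun, h, hij, hik, hjk, hij.symm, hik.symm, hjk.symm, aFun_invol]

theorem dir_comm (i j : Fin 3) (ω : ℕ → Fin 3) : dir i ω * dir j ω = dir j ω * dir i ω := by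
  by_cases hij : i = j
  · rw [hij]
  · obtain ⟨k, hik, hjk⟩ : ∃ k, i ≠ k ∧ j ≠ k := by
      revert i j; decide
    rw [dir_mul_dir hij hik hjk, dir_mul_dir (Ne.symm hij) hjk hik]

theorem dir_mul_dir_mul_dir_mul (i j : Fin 3) (ω : ℕ → Fin 3) (z : TreeAut) :
    dir i ω * (dir j ω * (dir i ω * z)) = dir j ω * z := by
  rw [← mul_assoc (dir j ω), dir_comm j i, mul_assoc, dir_mul_self_mul]

/-! ### The groups `G ω` -/

theorem a_mem (ω : ℕ → Fin 3) : a ∈ G ω := Subgroup.subset_closure (by simp)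

theorem dir_mem (k : Fin 3) (ω : ℕ → Fin 3) : dir k ω ∈ G ω := by
  apply Subgroup.subset_closure
  fin_cases k <;> simp [b, c, d]

theorem G_induction {ω : ℕ → Fin 3} {P : TreeAut → Prop} (one : P 1)
    (ha : ∀ g ∈ G ω, P g → P (a * g)) (hd : ∀ k, ∀ g ∈ G ω, P g → P (dir k ω * g))
    {g : TreeAut} (hg : g ∈ G ω) : P g := by
  induction hg using Subgroup.closure_induction_left with
  | one => exact one
  | mul_left x hx y hy ih =>
    rcases hx with rfl | rfl | rfl | rfl
    exacts [ha y hy ih, hd _ y hy ih, hd _ y hy ih, hd _ y hy ih]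
  | inv_mul_cancel x hx y hy ih =>
    rcases hx with rfl | rfl | rfl | rfl
    · rw [a_inv]; exact ha y hy ih
    all_goals
      simp only [b, c, d, dir_inv]
      exact hd _ y hy ih

/-- The self-similarity of the family `G ω`: the sections of the elements of `G ω` at the first
level lie in `G (shift 1 ω)`. -/
theorem exists_pair_of_mem {ω : ℕ → Fin 3} {g : TreeAut} (hg : g ∈ G ω) :
    ∃ g₀ ∈ G (shift 1 ω), ∃ g₁ ∈ G (shift 1 ω), g = pair g₀ g₁ ∨ g = a * pair g₀ g₁ := by
  refine G_induction (P := fun g => ∃ g₀ ∈ G (shift 1 ω), ∃ g₁ ∈ G (shift 1 ω),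
    g = pair g₀ g₁ ∨ g = a * pair g₀ g₁)
    ⟨1, one_mem _, 1, one_mem _, Or.inl pair_one_one.symm⟩ ?_ ?_ hg
  · rintro g - ⟨g₀, h₀, g₁, h₁, rfl | rfl⟩
    · exact ⟨g₀, h₀, g₁, h₁, Or.inr rfl⟩
    · exact ⟨g₀, h₀, g₁, h₁, Or.inl (by simp)⟩
  · rintro k g - ⟨g₀, h₀, g₁, h₁, hg⟩
    have hs : (if ω 0 = k then 1 else a : TreeAut) ∈ G (shift 1 ω) := by
      split_ifs
      exacts [one_mem _, a_mem _]
    have hd := dir_mem k (shift 1 ω)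
    rcases hg with rfl | rfl
    · exact ⟨_, mul_mem hs h₀, _, mul_mem hd h₁, Or.inl (by rw [dir_eq, pair_mul])⟩
    · exact ⟨_, mul_mem hd h₀, _, mul_mem hs h₁, Or.inr (by simp [dir_eq k ω])⟩

/-- The stabiliser of the first level of `G ω` projects onto `G (shift 1 ω)`. -/
theorem exists_pair_mem {ω : ℕ → Fin 3} {h : TreeAut} (hh : h ∈ G (shift 1 ω)) :
    ∃ g, pair g h ∈ G ω := by
  refine G_induction (P := fun h => ∃ g, pair g h ∈ G ω) ⟨1, by simp [one_mem]⟩ ?_ ?_ hh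
  · rintro h - ⟨g, hg⟩
    obtain ⟨j, hj⟩ : ∃ j, ω 0 ≠ j := (exists_ne (ω 0)).imp fun _ h => h.symm
    refine ⟨dir j (shift 1 ω) * g, ?_⟩
    have : a * dir j ω * a * pair g h ∈ G ω :=
      mul_mem (mul_mem (mul_mem (a_mem _) (dir_mem _ _)) (a_mem _)) hg
    simpa [dir_eq_of_ne hj, mul_assoc] using this
  · rintro k h - ⟨g, hg⟩
    exact ⟨_, by simpa [dir_eq k ω] using mul_mem (dir_mem k ω) hg⟩

theorem pair_swap_mem {ω : ℕ → Fin 3} {g h : TreeAut} (hg : pair g h ∈ G ω) : pair h g ∈ G ω := by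
  simpa [mul_assoc] using mul_mem (mul_mem (a_mem ω) hg) (a_mem ω)

theorem isLevelTransitive_G (ω : ℕ → Fin 3) : IsLevelTransitive (G ω) := by
  intro u
  induction u generalizing ω with
  | nil =>
    intro v hv
    exact ⟨1, one_mem _, by simpa using (List.length_eq_zero_iff.1 hv.symm).symm⟩
  | cons x u ih =>
    rintro (_ | ⟨y, v⟩) hv
    · simp at hv
    · obtain ⟨h, hh, e⟩ := ih (shift 1 ω) v (by simpa using hv)
      obtain ⟨g, hg⟩ := exists_pair_mem hh
      -- an element that fixes the first letter `x` and acts as `h` below it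
      have key : ∃ f ∈ G ω, f (x :: u) = x :: v := by
        cases x
        · exact ⟨_, pair_swap_mem hg, by simp [e]⟩
        · exact ⟨_, hg, by simp [e]⟩
      obtain ⟨f, hf, e'⟩ := key
      by_cases hxy : x = y
      · exact ⟨f, hf, by rw [e', hxy]⟩
      · refine ⟨a * f, mul_mem (a_mem _) hf, ?_⟩
        rw [RelIso.mul_apply, e', a_cons]
        cases x <;> cases y <;> simp_all

/-! ### Levels and their signs -/

theorem length_le_length_apply (g : TreeAut) (v : List Bool) : v.length ≤ (g v).length := by
  induction v using List.reverseRecOn with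
  | nil => simp
  | append_singleton v x ih =>
    have h : g v <+: g (v ++ [x]) := g.map_rel_iff.2 (List.prefix_append v [x])
    have hne : g v ≠ g (v ++ [x]) := fun e => by simpa using g.injective e
    have hlt : (g v).length < (g (v ++ [x])).length :=
      lt_of_le_of_ne h.length_le fun e => hne (h.eq_of_length e)
    simp only [List.length_append, List.length_singleton]
    omega

theorem length_apply (g : TreeAut) (v : List Bool) : (g v).length = v.length :=
  le_antisymm (by simpa using length_le_length_apply g.symm (g v)) (length_le_length_apply g v)

/-- The action on the `n`-th level of the tree. -/
def levelPerm (n : ℕ) : TreeAut →* Equiv.Perm (List.Vector Bool n) where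
  toFun g :=
    { toFun := fun v => ⟨g v.1, by rw [length_apply, v.2]⟩
      invFun := fun v => ⟨g.symm v.1, by rw [length_apply, v.2]⟩
      left_inv := fun v => Subtype.ext (by simp)
      right_inv := fun v => Subtype.ext (by simp) }
  map_one' := rfl
  map_mul' _ _ := rfl

/-- The kernel of the action on the `n`-th level. -/
def levelFix (n : ℕ) : Subgroup TreeAut := (levelPerm n).ker

theorem mem_levelFix {n : ℕ} {g : TreeAut} :
    g ∈ levelFix n ↔ ∀ v : List Bool, v.length = n → g v = v := by
  rw [levelFix, MonoidHom.mem_ker]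
  refine ⟨fun h v hv => ?_, fun h => ?_⟩
  · exact congrArg Subtype.val (DFunLike.congr_fun h (⟨v, hv⟩ : List.Vector Bool n))
  · ext1 v
    exact Subtype.ext (h v.1 v.2)

theorem levelFix_antitone : Antitone levelFix := by
  intro m n hmn g hg
  rw [mem_levelFix] at hg ⊢
  intro v hv
  have h1 : g v <+: v ++ List.replicate (n - m) false := by
    rw [← hg (v ++ List.replicate (n - m) false) (by simp; omega)]
    exact g.map_rel_iff.2 (List.prefix_append _ _)
  exact (List.prefix_of_prefix_length_le h1 (List.prefix_append _ _)
    (length_apply g v).le).eq_of_length (length_apply g v)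

theorem pair_mem_levelFix {n : ℕ} {g h : TreeAut} :
    pair g h ∈ levelFix (n + 1) ↔ g ∈ levelFix n ∧ h ∈ levelFix n := by
  simp only [mem_levelFix]
  refine ⟨fun H => ⟨fun v hv => ?_, fun v hv => ?_⟩, fun H v hv => ?_⟩
  · simpa using H (false :: v) (by simpa using hv)
  · simpa using H (true :: v) (by simpa using hv)
  · rcases v with _ | ⟨_ | _, v⟩
    · rfl
    · simpa using H.1 v (by simpa using hv)
    · simpa using H.2 v (by simpa using hv)

theorem a_mul_pair_notMem_levelFix (n : ℕ) (g h : TreeAut) :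
    a * pair g h ∉ levelFix (n + 1) := by
  intro H
  have := mem_levelFix.1 H (false :: List.replicate n false) (by simp)
  simp at this

theorem exists_pair_of_mem_levelFix {ω : ℕ → Fin 3} {n : ℕ} {g : TreeAut} (hg : g ∈ G ω)
    (hn : g ∈ levelFix (n + 1)) :
    ∃ g₀ ∈ G (shift 1 ω) ⊓ levelFix n, ∃ g₁ ∈ G (shift 1 ω) ⊓ levelFix n, g = pair g₀ g₁ := by
  obtain ⟨g₀, h₀, g₁, h₁, rfl | rfl⟩ := exists_pair_of_mem hg
  · rw [pair_mem_levelFix] at hn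
    exact ⟨g₀, ⟨h₀, hn.1⟩, g₁, ⟨h₁, hn.2⟩, rfl⟩
  · exact absurd hn (a_mul_pair_notMem_levelFix _ _ _)

/-- The sign of the action on the `n`-th level. For `n ≥ 1` it is the parity of the number of vertices
of level `n - 1` below which the two subtrees are swapped. -/
def levelSign (n : ℕ) : TreeAut →* ℤˣ := Equiv.Perm.sign.comp (levelPerm n)

theorem levelSign_of_mem {n : ℕ} {g : TreeAut} (hg : g ∈ levelFix n) : levelSign n g = 1 := by
  rw [levelSign, MonoidHom.comp_apply, (MonoidHom.mem_ker).1 hg, map_one]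

/-- A vertex of level `n + 1` is a first letter together with a vertex of level `n`. -/
def levelSucc (n : ℕ) : Bool × List.Vector Bool n ≃ List.Vector Bool (n + 1) where
  toFun p := p.1 ::ᵥ p.2
  invFun v := (v.head, v.tail)
  left_inv p := by simp
  right_inv v := by simp

theorem levelSign_pair (n : ℕ) (g h : TreeAut) :
    levelSign (n + 1) (pair g h) = levelSign n g * levelSign n h := by
  have : levelPerm (n + 1) (pair g h) = (levelSucc n).permCongr
      (Equiv.prodCongrRight fun x => bif x then levelPerm n h else levelPerm n g) := by
    ext1 ⟨v, hv⟩
    rcases v with _ | ⟨_ | _, w⟩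
    · simp at hv
    all_goals rfl
  simp only [levelSign, MonoidHom.comp_apply, this, Equiv.Perm.sign_permCongr,
    Equiv.Perm.sign_prodCongrRight, Fintype.prod_bool, cond_true, cond_false]
  exact mul_comm _ _

theorem levelSign_a_aux (n : ℕ) : levelSign (n + 1) a = (-1) ^ 2 ^ n := by
  have : levelPerm (n + 1) a = (levelSucc n).permCongr
      (Equiv.prodCongrLeft fun _ => Equiv.swap false true) := by
    ext1 ⟨v, hv⟩
    rcases v with _ | ⟨_ | _, w⟩
    · simp at hv
    all_goals rfl
  rw [levelSign, MonoidHom.comp_apply, this, Equiv.Perm.sign_permCongr,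
    Equiv.Perm.sign_prodCongrLeft]
  simp

theorem levelSign_one_a : levelSign 1 a = -1 := by
  simpa using levelSign_a_aux 0

theorem levelSign_a (n : ℕ) : levelSign (n + 2) a = 1 := by
  rw [levelSign_a_aux, pow_succ, mul_comm, pow_mul]; simp

theorem levelSign_zero (g : TreeAut) : levelSign 0 g = 1 :=
  levelSign_of_mem (mem_levelFix.2 fun v hv => by
    rw [List.length_eq_zero_iff.1 hv, ← List.length_eq_zero_iff, length_apply]; rfl)

theorem levelSign_one_dir (k : Fin 3) (ω : ℕ → Fin 3) : levelSign 1 (dir k ω) = 1 := by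
  rw [dir_eq, levelSign_pair, levelSign_zero, levelSign_zero, one_mul]

theorem levelSign_dir (k : Fin 3) (ω : ℕ → Fin 3) (n : ℕ) :
    levelSign (n + 2) (dir k ω) = if ω n = k then 1 else -1 := by
  induction n generalizing ω with
  | zero =>
    rw [dir_eq, levelSign_pair, levelSign_one_dir]
    split_ifs <;> simp [levelSign_one_a]
  | succ n ih =>
    rw [dir_eq, levelSign_pair, ih, shift_apply]
    have : levelSign (n + 2) (if ω 0 = k then 1 else a) = 1 := by
      split_ifs
      exacts [map_one _, levelSign_a n]
    rw [this, one_mul]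

/-! ### Automorphisms supported below a vertex -/

/-- The automorphism that acts as `g` on the subtree below the vertex `u` and fixes all the other
vertices. -/
def put : List Bool → TreeAut →* TreeAut
  | [] => MonoidHom.id _
  | false :: u =>
    { toFun := fun g => pair (put u g) 1
      map_one' := by simp
      map_mul' := by simp }
  | true :: u =>
    { toFun := fun g => pair 1 (put u g)
      map_one' := by simp
      map_mul' := by simp }

@[simp] theorem put_nil (g : TreeAut) : put [] g = g := rfl
@[simp] theorem put_false (u : List Bool) (g : TreeAut) :
    put (false :: u) g = pair (put u g) 1 := rfl
@[simp] theorem put_true (u : List Bool) (g : TreeAut) :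
    put (true :: u) g = pair 1 (put u g) := rfl

theorem put_append (u v : List Bool) (g : TreeAut) : put (u ++ v) g = put u (put v g) := by
  induction u with
  | nil => rfl
  | cons x u ih => cases x <;> simp [ih]

theorem put_apply_of_not_prefix {u v : List Bool} (h : ¬ u <+: v) (g : TreeAut) :
    put u g v = v := by
  induction u generalizing v with
  | nil => simp at h
  | cons x u ih =>
    rcases v with _ | ⟨y, v⟩
    · cases x <;> rfl
    · rw [List.cons_prefix_cons] at h
      cases x <;> cases y <;> simp_all

/-- Elements of `G ω` that fix many levels are products of elements supported below the vertices of
a given level. -/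
theorem mem_of_forall_put_mem (n m : ℕ) {ω : ℕ → Fin 3} {K : Subgroup TreeAut}
    (hK : ∀ u : List Bool, u.length = n → ∀ y ∈ G (shift n ω) ⊓ levelFix m, put u y ∈ K)
    {g : TreeAut} (hg : g ∈ G ω) (hgn : g ∈ levelFix (m + n)) : g ∈ K := by
  induction n generalizing ω K g with
  | zero => exact hK [] rfl g ⟨hg, hgn⟩
  | succ n ih =>
    obtain ⟨g₀, h₀, g₁, h₁, rfl⟩ := exists_pair_of_mem_levelFix hg hgn
    have e : pair g₀ g₁ = put [false] g₀ * put [true] g₁ := by simp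
    rw [e]
    refine mul_mem ?_ ?_
    · exact ih (K := K.comap (put [false])) (ω := shift 1 ω)
        (fun u hu y hy => hK (false :: u) (by simp [hu]) y hy) h₀.1 h₀.2
    · exact ih (K := K.comap (put [true])) (ω := shift 1 ω)
        (fun u hu y hy => hK (true :: u) (by simp [hu]) y hy) h₁.1 h₁.2

/-! ### Normal closures -/

/-- The subgroup `H` normalises the subgroup `K`, which need not be contained in `H`. -/
def Normalizes (H K : Subgroup TreeAut) : Prop := ∀ g ∈ H, ∀ k ∈ K, g * k * g⁻¹ ∈ K

theorem Normalizes.conj_iff {H K : Subgroup TreeAut} (h : Normalizes H K) {g k : TreeAut}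
    (hg : g ∈ H) : g * k * g⁻¹ ∈ K ↔ k ∈ K :=
  ⟨fun hk => by simpa [mul_assoc] using h g⁻¹ (inv_mem hg) _ hk, h g hg k⟩

theorem Normalizes.commutator_mem {H K : Subgroup TreeAut} (h : Normalizes H K) {g k : TreeAut}
    (hg : g ∈ H) (hk : k ∈ K) : ⁅g, k⁆ ∈ K :=
  mul_mem (h g hg k hk) (inv_mem hk)

theorem normalizes_self (H : Subgroup TreeAut) : Normalizes H H := fun _ hg _ hk =>
  mul_mem (mul_mem hg hk) (inv_mem hg)

/-- The subgroup generated by the conjugates of `s` under the elements of `H`. -/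
def conjClosure (H : Subgroup TreeAut) (s : TreeAut) : Subgroup TreeAut :=
  Subgroup.closure {y | ∃ g ∈ H, y = g * s * g⁻¹}

theorem mem_conjClosure (H : Subgroup TreeAut) (s : TreeAut) : s ∈ conjClosure H s :=
  Subgroup.subset_closure ⟨1, one_mem _, by simp⟩

theorem conjClosure_le {H K : Subgroup TreeAut} {s : TreeAut} (h : Normalizes H K) (hs : s ∈ K) :
    conjClosure H s ≤ K := by
  rw [conjClosure, Subgroup.closure_le]
  rintro _ ⟨g, hg, rfl⟩
  exact h g hg s hs

theorem normalizes_conjClosure (H : Subgroup TreeAut) (s : TreeAut) :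
    Normalizes H (conjClosure H s) := by
  intro g hg k hk
  have : conjClosure H s ≤ (conjClosure H s).comap (MulAut.conj g).toMonoidHom := by
    rw [conjClosure, Subgroup.closure_le]
    rintro _ ⟨f, hf, rfl⟩
    exact Subgroup.subset_closure ⟨g * f, mul_mem hg hf, by simp [mul_assoc]⟩
  exact this hk

/-- If `G ω` normalises `K`, then `G (shift u.length ω)` normalises the group of all sections at `u`
of the elements of `K` that are supported below `u`. -/
theorem Normalizes.comap_put {ω : ℕ → Fin 3} {K : Subgroup TreeAut} (h : Normalizes (G ω) K)
    (u : List Bool) : Normalizes (G (shift u.length ω)) (K.comap (put u)) := by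
  induction u generalizing ω K with
  | nil => exact h
  | cons x u ih =>
    have key : ∀ x, Normalizes (G (shift 1 ω)) (K.comap (put [x])) := by
      rintro x g hg k hk
      obtain ⟨f, hf⟩ := exists_pair_mem hg
      cases x
      · simpa using h _ (pair_swap_mem hf) _ hk
      · simpa using h _ hf _ hk
    have := ih (key x)
    rwa [Subgroup.comap_comap, shift_shift_one, show (put [x]).comp (put u) = put (x :: u) from
      MonoidHom.ext fun g => (put_append [x] u g).symm] at this

theorem Normalizes.put_swap {ω : ℕ → Fin 3} {K : Subgroup TreeAut} (h : Normalizes (G ω) K)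
    {x : Bool} {u : List Bool} {s : TreeAut} (hs : put (x :: u) s ∈ K) (y : Bool) :
    put (y :: u) s ∈ K := by
  by_cases hxy : y = x
  · rwa [hxy]
  · have := h a (a_mem ω) _ hs
    cases x <;> cases y <;> simp_all [mul_assoc]

/-- Since `G ω` acts transitively on the levels, being supported below one or another vertex of
a level makes no difference for membership in a subgroup that `G ω` normalises. -/
theorem Normalizes.put_mem {ω : ℕ → Fin 3} {K : Subgroup TreeAut} (h : Normalizes (G ω) K)
    {u : List Bool} {s : TreeAut} (hs : put u s ∈ K) {v : List Bool} (hv : v.length = u.length)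
    {y : TreeAut} (hy : y ∈ conjClosure (G (shift u.length ω)) s) : put v y ∈ K := by
  induction u generalizing ω K v with
  | nil =>
    rw [List.length_eq_zero_iff.1 hv]
    exact conjClosure_le h hs hy
  | cons x u ih =>
    rcases v with _ | ⟨z, v⟩
    · simp at hv
    · have := ih (v := v) (h.comap_put [z])
        (by rw [Subgroup.mem_comap, ← put_append]; exact h.put_swap hs z) (by simpa using hv) hy
      rwa [Subgroup.mem_comap, ← put_append] at this

/-! ### The branching subgroups -/

/-- The normal closure `M ω l` of `⁅a, dir l ω⁆` in `G ω`. -/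
def M (ω : ℕ → Fin 3) (l : Fin 3) : Subgroup TreeAut := conjClosure (G ω) ⁅a, dir l ω⁆

theorem commutator_a_dir (l : Fin 3) (ω : ℕ → Fin 3) :
    ⁅a, dir l ω⁆ = a * dir l ω * a * dir l ω := by
  rw [commutatorElement_def, a_inv, dir_inv]

theorem commutator_mem_M (ω : ℕ → Fin 3) (l : Fin 3) : ⁅a, dir l ω⁆ ∈ M ω l := mem_conjClosure _ _

theorem normalizes_M (ω : ℕ → Fin 3) (l : Fin 3) : Normalizes (G ω) (M ω l) :=
  normalizes_conjClosure _ _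

theorem M_le_G (ω : ℕ → Fin 3) (l : Fin 3) : M ω l ≤ G ω :=
  conjClosure_le (normalizes_self _) ((normalizes_self _).commutator_mem (a_mem ω) (dir_mem l ω))

/-- Signs do not see commutators. -/
theorem levelSign_of_mem_M {ω : ℕ → Fin 3} {l : Fin 3} {g : TreeAut} (hg : g ∈ M ω l) (n : ℕ) :
    levelSign n g = 1 := by
  refine (conjClosure_le (K := (levelSign n).ker) (fun g _ k hk => ?_) ?_ hg :)
  · rw [MonoidHom.mem_ker] at hk ⊢
    simp [hk]
  · rw [MonoidHom.mem_ker, map_commutatorElement, commutatorElement_eq_one_iff_mul_comm, mul_comm]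

/-- The branching property of the family `M`: the group `M ω l` contains a copy of
`M (shift 1 ω) (ω 0)` below each vertex of the first level, whatever `l` is. -/
theorem Normalizes.put_single_mem {ω : ℕ → Fin 3} {K : Subgroup TreeAut} (h : Normalizes (G ω) K)
    {l : Fin 3} (hl : ⁅a, dir l ω⁆ ∈ K) (x : Bool) :
    M (shift 1 ω) (ω 0) ≤ K.comap (put [x]) := by
  have key : put [true] ⁅a, dir (ω 0) (shift 1 ω)⁆ ∈ K := by
    by_cases hp : l = ω 0
    · subst hp
      -- commute `⁅a, dir (ω 0) ω⁆`, which acts as `dir (ω 0)` on both subtrees, with an element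
      -- that acts as `a` on the second one
      obtain ⟨j, hj⟩ : ∃ j, ω 0 ≠ j := (exists_ne (ω 0)).imp fun _ h => h.symm
      have h1 := h.commutator_mem
        (mul_mem (mul_mem (a_mem ω) (dir_mem j ω)) (a_mem ω)) hl
      rw [commutator_a_dir, dir_eq_of_eq rfl, dir_eq_of_ne hj] at h1
      have e : dir j (shift 1 ω) * (dir (ω 0) (shift 1 ω) *
          (dir j (shift 1 ω) * dir (ω 0) (shift 1 ω))) = 1 := by
        rw [dir_mul_dir_mul_dir_mul, dir_mul_self]
      simpa [commutatorElement_def, mul_assoc, e] using h1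
    · have hp' : ω 0 ≠ l := Ne.symm hp
      have h1 := inv_mem (h.commutator_mem (dir_mem (ω 0) ω) hl)
      rw [commutator_a_dir, dir_eq_of_eq rfl, dir_eq_of_ne hp'] at h1
      simpa [commutatorElement_def, mul_assoc, dir_mul_dir_mul_dir_mul] using h1
  intro y hy
  exact h.put_mem key (v := [x]) rfl hy

theorem put_single_mem_M (ω : ℕ → Fin 3) (l : Fin 3) (x : Bool) {y : TreeAut}
    (hy : y ∈ M (shift 1 ω) (ω 0)) : put [x] y ∈ M ω l :=
  (normalizes_M ω l).put_single_mem (commutator_mem_M ω l) x hy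

theorem pair_mem_M {ω : ℕ → Fin 3} (l : Fin 3) {g h : TreeAut}
    (hg : g ∈ M (shift 1 ω) (ω 0)) (hh : h ∈ M (shift 1 ω) (ω 0)) : pair g h ∈ M ω l := by
  simpa using mul_mem (put_single_mem_M ω l false hg) (put_single_mem_M ω l true hh)

theorem Normalizes.put_mem_of_mem_M {ω : ℕ → Fin 3} {K : Subgroup TreeAut}
    (h : Normalizes (G ω) K) {l : Fin 3} (hl : ⁅a, dir l ω⁆ ∈ K) {n : ℕ} {u : List Bool}
    (hu : u.length = n + 1) : M (shift (n + 1) ω) (ω n) ≤ K.comap (put u) := by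
  induction n generalizing ω K u l with
  | zero =>
    obtain ⟨x, rfl⟩ := List.length_eq_one_iff.1 hu
    exact h.put_single_mem hl x
  | succ n ih =>
    rcases u with _ | ⟨x, u⟩
    · simp at hu
    · intro y hy
      have := ih (h.comap_put [x]) (h.put_single_mem hl x (commutator_mem_M _ _))
        (by simpa using hu) hy
      rwa [Subgroup.mem_comap, Subgroup.mem_comap, ← put_append] at this

theorem put_mem_G {ω : ℕ → Fin 3} {n : ℕ} {u : List Bool} (hu : u.length = n + 1) {y : TreeAut}
    (hy : y ∈ M (shift (n + 1) ω) (ω n)) : put u y ∈ G ω :=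
  (normalizes_self (G ω)).put_mem_of_mem_M (l := 0) (M_le_G ω 0 (commutator_mem_M ω 0)) hu hy

/-! ### The branching subgroups contain level stabilisers -/

/-- Modulo `M ω k` the involution `dir k ω` is central. -/
theorem commutator_dir_mem_M {ω : ℕ → Fin 3} (k : Fin 3) {g : TreeAut} (hg : g ∈ G ω) :
    ⁅g, dir k ω⁆ ∈ M ω k := by
  refine G_induction (P := fun g => ⁅g, dir k ω⁆ ∈ M ω k) (by simp [one_mem]) ?_ ?_ hg
  · intro g _ h
    have := mul_mem (normalizes_M ω k a (a_mem ω) _ h) (commutator_mem_M ω k)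
    simpa [commutatorElement_def, mul_assoc] using this
  · intro j g _ h
    have := normalizes_M ω k _ (dir_mem j ω) _ h
    rw [show ⁅dir j ω * g, dir k ω⁆ = dir j ω * ⁅g, dir k ω⁆ * (dir j ω)⁻¹ * ⁅dir j ω, dir k ω⁆ by
      simp [commutatorElement_def, mul_assoc],
      commutatorElement_eq_one_iff_mul_comm.2 (dir_comm j k ω), mul_one]
    exact this

/-- The normal closure of `dir k ω` in `G ω`, which consists of at most two cosets of `M ω k`. -/
def N (ω : ℕ → Fin 3) (k : Fin 3) : Subgroup TreeAut where
  carrier := {g | g ∈ M ω k ∨ g * dir k ω ∈ M ω k}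
  one_mem' := Or.inl (one_mem _)
  mul_mem' := by
    have conj : ∀ g ∈ M ω k, dir k ω * g * dir k ω ∈ M ω k := fun g hg => by
      simpa using normalizes_M ω k _ (dir_mem k ω) g hg
    rintro g h (hg | hg) (hh | hh)
    · exact Or.inl (mul_mem hg hh)
    · exact Or.inr (by simpa [mul_assoc] using mul_mem hg hh)
    · exact Or.inr (by simpa [mul_assoc] using mul_mem hg (conj _ hh))
    · exact Or.inl (by simpa [mul_assoc] using mul_mem hg (conj _ hh))
  inv_mem' := by
    rintro g (hg | hg)
    · exact Or.inl (inv_mem hg)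
    · exact Or.inr (by
        simpa [mul_assoc] using normalizes_M ω k _ (dir_mem k ω) _ (inv_mem hg))

theorem dir_mem_N (ω : ℕ → Fin 3) (k : Fin 3) : dir k ω ∈ N ω k :=
  Or.inr (by simp [one_mem])

theorem normalizes_N (ω : ℕ → Fin 3) (k : Fin 3) : Normalizes (G ω) (N ω k) := by
  rintro g hg n (hn | hn)
  · exact Or.inl (normalizes_M ω k g hg n hn)
  · refine Or.inr ?_
    have := mul_mem (normalizes_M ω k g hg _ hn) (commutator_dir_mem_M k hg)
    simpa [commutatorElement_def, mul_assoc] using this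

theorem levelSign_one_of_mem_N {ω : ℕ → Fin 3} {k : Fin 3} {g : TreeAut} (hg : g ∈ N ω k) :
    levelSign 1 g = 1 := by
  rcases hg with hg | hg
  · exact levelSign_of_mem_M hg 1
  · simpa [levelSign_one_dir] using levelSign_of_mem_M hg 1

/-- If the letter `k` does not occur at the position `n`, the sign on level `n + 2` tells the cosets
of `M ω k` in `N ω k` apart. -/
theorem mem_M_of_mem_N {ω : ℕ → Fin 3} {k : Fin 3} {n : ℕ} (hn : ω n ≠ k) {g : TreeAut}
    (hg : g ∈ N ω k) (hs : levelSign (n + 2) g = 1) : g ∈ M ω k := by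
  rcases hg with hg | hg
  · exact hg
  · have := levelSign_of_mem_M hg (n + 2)
    simp [hs, levelSign_dir, hn] at this

theorem a_mul_zpow (k : Fin 3) (ω : ℕ → Fin 3) (i : ℤ) :
    a * (a * dir k ω) ^ i = (a * dir k ω) ^ (-i) * a := by
  have h : a * (a * dir k ω) ^ i * a⁻¹ = (a * dir k ω) ^ (-i) := by
    rw [← conj_zpow, zpow_neg, ← inv_zpow]
    simp
  rw [← h]; simp [mul_assoc]

/-- Modulo the automorphisms whose two sections lie in the normal closure of the generator with
the trivial section at `0`, the group `G ω` is generated by `a` and one further involution, so it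
is a dihedral group. -/
theorem exists_eq_pair_mul_zpow {ω : ℕ → Fin 3} {j : Fin 3} (hj : ω 0 ≠ j) {g : TreeAut}
    (hg : g ∈ G ω) : ∃ n₀ ∈ N (shift 1 ω) (ω 0), ∃ n₁ ∈ N (shift 1 ω) (ω 0), ∃ i : ℤ,
      g = pair n₀ n₁ * (a * dir j ω) ^ i ∨ g = pair n₀ n₁ * (a * dir j ω) ^ i * a := by
  set P : TreeAut → Prop := fun g => ∃ n₀ ∈ N (shift 1 ω) (ω 0), ∃ n₁ ∈ N (shift 1 ω) (ω 0),
    ∃ i : ℤ, g = pair n₀ n₁ * (a * dir j ω) ^ i ∨ g = pair n₀ n₁ * (a * dir j ω) ^ i * a with hP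
  have one : P 1 := ⟨1, one_mem _, 1, one_mem _, 0, Or.inl (by simp)⟩
  have ha : ∀ g, P g → P (a * g) := by
    rintro g ⟨n₀, h₀, n₁, h₁, i, rfl | rfl⟩
    · refine ⟨n₁, h₁, n₀, h₀, -i, Or.inr ?_⟩
      rw [mul_assoc (pair n₁ n₀), ← a_mul_zpow]; simp
    · refine ⟨n₁, h₁, n₀, h₀, -i, Or.inl ?_⟩
      rw [← mul_assoc, ← mul_assoc, ← pair_mul_a, mul_assoc (pair n₁ n₀), a_mul_zpow]
      simp [mul_assoc]
  -- `dir j ω = a * (a * dir j ω)`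
  have hy : ∀ g, P g → P (a * dir j ω * g) := by
    rintro g ⟨n₀, h₀, n₁, h₁, i, h⟩
    refine ⟨_, normalizes_N _ _ _ (dir_mem j _) _ h₁, _, normalizes_N _ _ _ (a_mem _) _ h₀,
      i + 1, ?_⟩
    have e : a * dir j ω * pair n₀ n₁ =
        pair (dir j (shift 1 ω) * n₁ * (dir j (shift 1 ω))⁻¹) (a * n₀ * a⁻¹) * (a * dir j ω) := by
      rw [dir_eq_of_ne hj]; simp [mul_assoc]
    rw [add_comm i, zpow_add, zpow_one]
    rcases h with rfl | rfl
    · left; rw [← mul_assoc, e]; simp only [mul_assoc]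
    · right; rw [← mul_assoc, ← mul_assoc, e]; simp only [mul_assoc]
  have hj' : ∀ g, P g → P (dir j ω * g) := fun g h => by
    simpa [mul_assoc] using ha _ (hy g h)
  have hp : ∀ g, P g → P (dir (ω 0) ω * g) := by
    rintro g ⟨n₀, h₀, n₁, h₁, i, h⟩
    refine ⟨n₀, h₀, _, mul_mem (dir_mem_N _ _) h₁, i, ?_⟩
    rw [dir_eq_of_eq rfl]
    rcases h with rfl | rfl
    · left; simp
    · right; simp [mul_assoc]
  refine G_induction (P := P) one (fun g _ => ha g) (fun k g _ h => ?_) hg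
  by_cases hk : k = j
  · exact hk ▸ hj' g h
  by_cases hk' : k = ω 0
  · exact hk' ▸ hp g h
  · rw [← dir_mul_dir hj (Ne.symm hk') (Ne.symm hk), mul_assoc]
    exact hp _ (hj' _ h)

theorem commutator_a_dir_of_ne {ω : ℕ → Fin 3} {j : Fin 3} (hj : ω 0 ≠ j) :
    ⁅a, dir j ω⁆ = pair (dir j (shift 1 ω) * a) (a * dir j (shift 1 ω)) := by
  rw [commutator_a_dir, dir_eq_of_ne hj]; simp [mul_assoc]

/-- For an element that fixes sufficiently many levels, the decomposition of
`exists_eq_pair_mul_zpow` takes a special form. The signs of its sections on the first level force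
an even power of `⁅a, dir j ω⁆`, and those on level `n + 2` force sections in `M`. -/
theorem exists_eq_pair_mul_commutator_zpow {ω : ℕ → Fin 3} {j : Fin 3} (hj : ω 0 ≠ j) {n : ℕ}
    (hn : ω (n + 1) ≠ ω 0) {g : TreeAut} (hg : g ∈ G ω) (hgn : g ∈ levelFix (n + 3)) :
    ∃ n₀ ∈ M (shift 1 ω) (ω 0), ∃ n₁ ∈ M (shift 1 ω) (ω 0), ∃ k : ℤ,
      g = pair n₀ n₁ * ⁅a, dir j ω⁆ ^ (2 * k) := by
  obtain ⟨n₀, h₀, n₁, h₁, i, h⟩ := exists_eq_pair_mul_zpow hj hg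
  have s1 : ∀ x y : TreeAut, pair x y ∈ levelFix (n + 3) → levelSign 1 x = 1 ∧ levelSign 1 y = 1 :=
    fun x y hxy => by
      have := pair_mem_levelFix.1 hxy
      exact ⟨levelSign_of_mem (levelFix_antitone (by omega) this.1),
        levelSign_of_mem (levelFix_antitone (by omega) this.2)⟩
  have hr : (a * dir j ω) ^ (2 : ℤ) = ⁅a, dir j ω⁆ := by
    rw [commutator_a_dir, zpow_two]; simp only [mul_assoc]
  have e0 := levelSign_one_of_mem_N h₀
  have e1 := levelSign_one_of_mem_N h₁
  have ey := levelSign_one_dir j (shift 1 ω)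
  have hsq : ∀ k : ℤ, (-1 : ℤˣ) ^ k = 1 → Even k := fun k hk => by
    by_contra h
    rw [(Int.not_even_iff_odd.1 h).neg_one_zpow] at hk
    exact absurd hk (by decide)
  rcases Int.even_or_odd' i with ⟨k, rfl | rfl⟩
  · rw [zpow_mul, hr] at h
    rcases h with rfl | rfl
    · have hgn' := hgn
      rw [commutator_a_dir_of_ne hj, pair_zpow, pair_mul] at hgn'
      obtain ⟨k', rfl⟩ := hsq k (by
        simpa [e1, ey, levelSign_one_a, mul_zpow] using (s1 _ _ hgn').2)
      have hs := pair_mem_levelFix.1 hgn'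
      have t0 := levelSign_of_mem hs.1
      have t1 := levelSign_of_mem hs.2
      rw [map_mul, zpow_add, map_mul, Int.units_mul_self, mul_one] at t0 t1
      exact ⟨n₀, mem_M_of_mem_N (ω := shift 1 ω) hn h₀ t0,
        n₁, mem_M_of_mem_N (ω := shift 1 ω) hn h₁ t1, k', by rw [two_mul]⟩
    · rw [commutator_a_dir_of_ne hj, pair_zpow, pair_mul, pair_mul_a] at hgn
      exact absurd hgn (a_mul_pair_notMem_levelFix _ _ _)
  · rw [zpow_add, zpow_mul, hr, zpow_one] at h
    rcases h with rfl | rfl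
    · rw [commutator_a_dir_of_ne hj, pair_zpow, dir_eq_of_ne hj] at hgn
      simp only [pair_mul, pair_mul_a_mul] at hgn
      exact absurd hgn (a_mul_pair_notMem_levelFix _ _ _)
    · rw [commutator_a_dir_of_ne hj, pair_zpow, dir_eq_of_ne hj, mul_assoc, mul_assoc,
        mul_assoc a, pair_mul_a, a_mul_a_mul, pair_mul, pair_mul] at hgn
      have t := s1 _ _ hgn
      simp only [map_mul, map_zpow, e0, e1, ey, levelSign_one_a, one_mul, mul_one] at t
      rw [t.1] at t
      exact absurd t.2 (by decide)

theorem exists_ne_of_not_const {ω : ℕ → Fin 3} (hω : ∀ n, ∃ m ≥ n, ω (m + 1) ≠ ω m)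
    (k : Fin 3) : ∃ n, ω n ≠ k := by
  obtain ⟨m, -, hm⟩ := hω 0
  by_contra! h
  exact hm (by rw [h, h])

theorem not_const_shift {ω : ℕ → Fin 3} (hω : ∀ n, ∃ m ≥ n, ω (m + 1) ≠ ω m) (k : ℕ) (n : ℕ) :
    ∃ m ≥ n, shift k ω (m + 1) ≠ shift k ω m := by
  obtain ⟨m, hm, h⟩ := hω (n + k)
  refine ⟨m - k, by omega, ?_⟩
  rw [shift_apply, shift_apply, show m - k + 1 + k = m + 1 by omega, show m - k + k = m by omega]
  exact h

theorem exists_levelFix_le_M_of_ne {ω : ℕ → Fin 3} (hω : ∀ n, ∃ m ≥ n, ω (m + 1) ≠ ω m)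
    {l : Fin 3} (hl : ω 0 ≠ l) : ∃ m, G ω ⊓ levelFix m ≤ M ω l := by
  obtain ⟨n, hn⟩ := exists_ne_of_not_const (not_const_shift hω 1) (ω 0)
  refine ⟨n + 3, fun g hg => ?_⟩
  obtain ⟨n₀, h₀, n₁, h₁, k, rfl⟩ := exists_eq_pair_mul_commutator_zpow hl hn hg.1 hg.2
  exact mul_mem (pair_mem_M l h₀ h₁) (zpow_mem (commutator_mem_M ω l) _)

/-- If `ω` is not eventually constant, each `M ω l` contains a level stabiliser of `G ω`. -/
theorem exists_levelFix_le_M {ω : ℕ → Fin 3} (hω : ∀ n, ∃ m ≥ n, ω (m + 1) ≠ ω m) (l : Fin 3) :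
    ∃ m, G ω ⊓ levelFix m ≤ M ω l := by
  obtain ⟨t, ht⟩ := exists_ne_of_not_const hω l
  induction t generalizing ω with
  | zero => exact exists_levelFix_le_M_of_ne hω ht
  | succ t ih =>
    obtain ⟨m, hm⟩ := ih (not_const_shift hω 1) ht
    by_cases h0 : ω 0 = l
    · refine ⟨m + 1, fun g hg => ?_⟩
      obtain ⟨g₀, hg₀, g₁, hg₁, rfl⟩ := exists_pair_of_mem_levelFix hg.1 hg.2
      exact pair_mem_M l (h0 ▸ hm hg₀) (h0 ▸ hm hg₁)
    · exact exists_levelFix_le_M_of_ne hω h0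

/-! ### Commutators of the branching subgroups -/

/-- The elements that commute with `M ω p` modulo `J` form a normal subgroup of `G ω`. If it contains
`a * dir l ω`, then it also contains `⁅a, dir p ω⁆`. -/
theorem commutator_commutator_mem {ω : ℕ → Fin 3} {l p : Fin 3} {J : Subgroup TreeAut}
    (hJ : Normalizes (G ω) J) (h : ∀ m ∈ M ω p, ⁅a * dir l ω, m⁆ ∈ J) {m : TreeAut}
    (hm : m ∈ M ω p) : ⁅⁅a, dir p ω⁆, m⁆ ∈ J := by
  have hxp := dir_mem p ω
  have hr : a * dir l ω ∈ G ω := mul_mem (a_mem ω) (dir_mem l ω)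
  have hM := normalizes_M ω p
  -- `⁅dir p ω, a * dir l ω⁆ = ⁅dir p ω, a⁆`, because `dir p ω` and `dir l ω` commute
  have e : dir p ω * (a * dir l ω) * (dir p ω)⁻¹ * (a * dir l ω)⁻¹ = ⁅a, dir p ω⁆⁻¹ := by
    rw [dir_inv, mul_assoc (dir p ω), mul_assoc a, dir_comm l p]
    simp [commutatorElement_def, mul_assoc]
  have h1 : ∀ m ∈ M ω p, ⁅dir p ω * (a * dir l ω) * (dir p ω)⁻¹, m⁆ ∈ J := fun m hm => by
    have := hJ _ hxp _ (h _ (hM _ (inv_mem hxp) m hm))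
    simpa [commutatorElement_def, mul_assoc] using this
  have h2 : ∀ m ∈ M ω p, ⁅(a * dir l ω)⁻¹, m⁆ ∈ J := fun m hm => by
    have := hJ _ (inv_mem hr) _ (inv_mem (h m hm))
    simpa [commutatorElement_def, mul_assoc] using this
  have h3 : ∀ m ∈ M ω p, ⁅⁅a, dir p ω⁆⁻¹, m⁆ ∈ J := fun m hm => by
    have hc := mul_mem (mul_mem hxp hr) (inv_mem hxp)
    have := mul_mem (hJ _ hc _ (h2 m hm)) (h1 m hm)
    rw [← e]
    simpa [commutatorElement_def, mul_assoc] using this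
  have := hJ _ (M_le_G _ _ (commutator_mem_M ω p)) _ (inv_mem (h3 m hm))
  generalize ⁅a, dir p ω⁆ = t at this ⊢
  simpa [commutatorElement_def, mul_assoc] using this

/-- If the letter `ω 0` differs from `l`, the commutator of `a * dir l ω` and `⁅a, dir p ω⁆` is
supported below a vertex of the first level. -/
theorem put_single_mem_of_ne {ω : ℕ → Fin 3} {l p : Fin 3} (hlp : l ≠ p) (h0 : ω 0 ≠ l)
    {J : Subgroup TreeAut} (hJ : Normalizes (G ω) J) (h : ∀ m ∈ M ω p, ⁅a * dir l ω, m⁆ ∈ J) :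
    put [true] ⁅a, dir (ω 0) (shift 1 ω)⁆ ∈ J := by
  have h1 := h _ (commutator_mem_M ω p)
  by_cases hp : ω 0 = p
  · subst hp
    rw [commutator_a_dir, dir_eq_of_eq rfl, dir_eq_of_ne h0] at h1
    simpa [commutatorElement_def, mul_assoc, dir_mul_dir_mul_dir_mul] using h1
  · rw [commutator_a_dir, dir_eq_of_ne hp, dir_eq_of_ne h0,
      ← dir_mul_dir (Ne.symm h0) hlp hp] at h1
    have h2 : put [false] (dir l (shift 1 ω) * ⁅a, dir (ω 0) (shift 1 ω)⁆ *
        (dir l (shift 1 ω))⁻¹) ∈ J := by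
      simpa [commutatorElement_def, mul_assoc, dir_mul_dir_mul_dir_mul] using h1
    exact hJ.put_swap (((hJ.comap_put [false]).conj_iff (dir_mem l (shift 1 ω))).1 h2) true

theorem commutator_mul_sq {ω : ℕ → Fin 3} {l p : Fin 3} (hlp : l ≠ p) (h0 : ω 0 = l) :
    ⁅a * dir l ω, ⁅a, dir p ω⁆⁆ * ⁅a, dir p ω⁆ ^ 2 = put [false] ⁅dir l (shift 1 ω), a⁆ := by
  have h0' : ω 0 ≠ p := h0 ▸ hlp
  rw [commutator_a_dir_of_ne h0', dir_eq_of_eq h0]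
  simp [commutatorElement_def, mul_assoc, pow_two, dir_mul_dir_mul_dir_mul]

theorem commutator_pow_four {ω : ℕ → Fin 3} {p : Fin 3} (h0 : ω 0 ≠ p) (h1 : ω 1 = p) :
    ⁅a, dir p ω⁆ ^ 4 = 1 := by
  have h1' : shift 1 ω 0 = p := h1
  rw [commutator_a_dir_of_ne h0, dir_eq_of_eq h1']
  simp [pow_succ, mul_assoc]

theorem exists_put_mem_of_commutator_mem {ω : ℕ → Fin 3} {l p : Fin 3} (hlp : l ≠ p)
    {J : Subgroup TreeAut} (hJ : Normalizes (G ω) J) (h : ∀ m ∈ M ω p, ⁅a * dir l ω, m⁆ ∈ J) :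
    put [true, true] ⁅a, dir (ω 1) (shift 2 ω)⁆ ∈ J := by
  by_cases h0 : ω 0 = l
  · have h0' : ω 0 ≠ p := h0 ▸ hlp
    -- the hypotheses hold for `shift 1 ω` and `J.comap (put [true])`, with `l` and `p` interchanged
    have hJ1 : Normalizes (G (shift 1 ω)) (J.comap (put [true])) := hJ.comap_put [true]
    have h' : ∀ m ∈ M (shift 1 ω) l, ⁅a * dir p (shift 1 ω), m⁆ ∈ J.comap (put [true]) := by
      intro m hm
      have := commutator_commutator_mem hJ h (put_single_mem_M ω p true (h0 ▸ hm))
      rw [commutator_a_dir_of_ne h0'] at this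
      simpa [commutatorElement_def, mul_assoc] using this
    by_cases h1 : ω 1 = p
    · have h1' : shift 1 ω 0 = p := h1
      set z := ⁅a * dir l ω, ⁅a, dir p ω⁆⁆ with hz
      have hzJ : z ∈ J := h _ (commutator_mem_M ω p)
      have hs := commutator_mul_sq hlp h0
      -- `⁅a, dir p ω⁆` has order dividing four, so the square of `z * ⁅a, dir p ω⁆ ^ 2` is a product
      -- of conjugates of `z`
      have hsq : put [false] (⁅dir l (shift 1 ω), a⁆ ^ 2) ∈ J := by
        rw [map_pow, ← hs, ← hz]
        have h4 := commutator_pow_four h0' h1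
        set t := ⁅a, dir p ω⁆ with ht
        have htG : t ^ 2 ∈ G ω := pow_mem (M_le_G _ _ (commutator_mem_M ω p)) 2
        have := mul_mem hzJ (hJ _ htG _ hzJ)
        rwa [show z * (t ^ 2 * z * (t ^ 2)⁻¹) = (z * t ^ 2) ^ 2 by
          rw [pow_two (z * t ^ 2), show (t ^ 2)⁻¹ = t ^ 2 by
            rw [inv_eq_iff_mul_eq_one, ← pow_add, h4]]
          simp only [mul_assoc]] at this
      have hsq' : ⁅a, dir l (shift 1 ω)⁆ ^ 2 ∈ J.comap (put [true]) := by
        have := inv_mem (hJ.put_swap hsq true)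
        rwa [← map_inv, ← inv_pow, commutatorElement_inv] at this
      have h2 := mul_mem (h' _ (commutator_mem_M _ l)) hsq'
      rw [commutator_mul_sq hlp.symm h1'] at h2
      have h3 := inv_mem (hJ1.put_swap h2 true)
      rw [← map_inv, commutatorElement_inv, Subgroup.mem_comap, ← put_append] at h3
      subst h1
      exact h3
    · have := put_single_mem_of_ne hlp.symm (ω := shift 1 ω) h1 hJ1 h'
      rwa [Subgroup.mem_comap, ← put_append] at this
  · have h1 := put_single_mem_of_ne hlp h0 hJ h
    have h2 := (hJ.comap_put [true]).put_single_mem h1 true (commutator_mem_M _ _)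
    rwa [Subgroup.mem_comap, Subgroup.mem_comap, ← put_append] at h2

/-- The commutator subgroup of `M ω l` contains a branching subgroup below a vertex of the third
level. By conjugation it then contains one below each of them. -/
theorem put_mem_of_commutator_M {ω : ℕ → Fin 3} {l : Fin 3} (hl : ω 0 ≠ l)
    {K : Subgroup TreeAut} (hK : Normalizes (G ω) K) (h : ∀ y ∈ M ω l, ∀ z ∈ M ω l, ⁅y, z⁆ ∈ K) :
    put [true, true, true] ⁅a, dir (ω 2) (shift 3 ω)⁆ ∈ K := by
  have := exists_put_mem_of_commutator_mem (ω := shift 1 ω) (J := K.comap (put [true]))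
    hl.symm (hK.comap_put [true]) fun m hm => by
      have := h _ (commutator_mem_M ω l) _ (put_single_mem_M ω l true hm)
      rw [commutator_a_dir_of_ne hl] at this
      simpa [commutatorElement_def, mul_assoc] using this
  rwa [Subgroup.mem_comap, ← put_append] at this

/-! ### Normal subgroups contain level stabilisers -/

/-- Automorphisms supported below incomparable vertices commute. -/
theorem commute_of_fix {v w : List Bool} (hl : v.length = w.length) (hvw : v ≠ w) {f g : TreeAut}
    (hf : ∀ x, ¬ v <+: x → f x = x) (hg : ∀ x, ¬ w <+: x → g x = x) : f * g = g * f := by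
  have hdis : Equiv.Perm.Disjoint f.toEquiv g.toEquiv := fun x => by
    by_cases hv : v <+: x
    · exact Or.inr (hg x fun hw => hvw
        ((List.prefix_of_prefix_length_le hv hw hl.le).eq_of_length hl))
    · exact Or.inl (hf x hv)
  ext1 x
  exact DFunLike.congr_fun hdis.commute.eq x

/-- If `g` moves the vertex `v`, then the commutators of automorphisms supported below `v` are
products of conjugates of `g` and `g⁻¹`: conjugation by `g` moves the support away from `v`. -/
theorem put_commutator_mem {H K : Subgroup TreeAut} (hK : Normalizes H K) {g : TreeAut}
    (hg : g ∈ K) {v : List Bool} (hv : g v ≠ v) {y z : TreeAut} (hgy : put v y ∈ H)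
    (hgz : put v z ∈ H) : put v ⁅y, z⁆ ∈ K := by
  have hc : (g * put v y⁻¹ * g⁻¹) * put v z = put v z * (g * put v y⁻¹ * g⁻¹) := by
    refine commute_of_fix (length_apply g v) hv (fun x hx => ?_) fun x hx =>
      put_apply_of_not_prefix hx z
    have : ¬ v <+: g⁻¹ x := fun h => hx (by
      have := g.map_rel_iff.2 h
      rwa [RelIso.apply_inv_self] at this)
    rw [RelIso.mul_apply, RelIso.mul_apply, put_apply_of_not_prefix this, RelIso.apply_inv_self]
  have h1 : put v y * g * (put v y)⁻¹ * g⁻¹ ∈ K := mul_mem (hK _ hgy _ hg) (inv_mem hg)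
  have h2 := mul_mem h1 (inv_mem (hK _ hgz _ h1))
  rw [map_inv] at hc
  have e : put v z * (put v y * g * (put v y)⁻¹ * g⁻¹) * (put v z)⁻¹ =
      put v z * put v y * (put v z)⁻¹ * (g * (put v y)⁻¹ * g⁻¹) := by
    have := (show Commute _ _ from hc).inv_right.eq
    simp only [mul_assoc] at this ⊢
    rw [this]
  rw [e] at h2
  simpa [commutatorElement_def, mul_assoc] using h2

/-- If `ω` is not eventually constant, every nontrivial normal subgroup of `G ω` contains a level
stabiliser. -/
theorem exists_levelFix_le_of_normalizes {ω : ℕ → Fin 3} (hω : ∀ n, ∃ m ≥ n, ω (m + 1) ≠ ω m)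
    {K : Subgroup TreeAut} (hK : Normalizes (G ω) K) (hne : K ≠ ⊥) :
    ∃ m, G ω ⊓ levelFix m ≤ K := by
  obtain ⟨⟨g, hg⟩, hg1⟩ := Subgroup.ne_bot_iff_exists_ne_one.1 hne
  obtain ⟨w, hw⟩ : ∃ w, g w ≠ w := by
    by_contra! h
    exact hg1 (Subtype.ext (RelIso.ext h))
  obtain ⟨n, hn, hne⟩ := hω w.length
  -- a vertex of level `n + 1` below `w`, which is moved too
  set v := w ++ List.replicate (n + 1 - w.length) false with hvdef
  have hvl : v.length = n + 1 := by simp [hvdef]; omega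
  have hv : g v ≠ v := fun h => hw <| by
    have h1 : g w <+: v := by
      rw [← h]; exact g.map_rel_iff.2 (List.prefix_append _ _)
    exact (List.prefix_of_prefix_length_le h1 (List.prefix_append _ _)
      (length_apply _ w).le).eq_of_length (length_apply _ w)
  have hKv := hK.comap_put v
  rw [hvl] at hKv
  have h3 := put_mem_of_commutator_M (ω := shift (n + 1) ω) (l := ω n)
    (by simpa using hne) hKv fun y hy z hz =>
      put_commutator_mem hK hg hv (put_mem_G hvl hy) (put_mem_G hvl hz)
  rw [Subgroup.mem_comap, ← put_append] at h3
  obtain ⟨m, hm⟩ := exists_levelFix_le_M (not_const_shift hω (n + 4))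
    (ω (n + 3))
  refine ⟨m + (n + 4), fun f hf => mem_of_forall_put_mem (n + 4) m (fun u hu y hy => ?_) hf.1 hf.2⟩
  refine hK.put_mem h3 (by simp [hu, hvl]) ?_
  have e1 : (shift 3 (shift (n + 1) ω)) = shift (n + 4) ω := by
    ext i; simp [add_assoc, add_comm, add_left_comm]
  have e2 : shift (n + 1) ω 2 = ω (n + 3) := by
    rw [shift_apply]; congr 1; omega
  rw [show (v ++ [true, true, true]).length = n + 4 by simp [hvl], e1, e2]
  exact hm hy

/-! ### Consequences for the abstract group `G ω` -/

theorem map_subtype_levelStab_le {H K : Subgroup TreeAut} {L : Subgroup H} {n : ℕ}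
    (h : H ⊓ levelFix n ≤ K) (hK : K ≤ L.map H.subtype) : levelStab H n ≤ L := by
  intro g hg
  obtain ⟨f, hf, e⟩ := hK (h ⟨g.2, mem_levelFix.2 fun v hv => hg v hv⟩)
  rwa [← Subtype.ext (e : (f : TreeAut) = g)]

theorem finiteIndex_levelStab (H : Subgroup TreeAut) (n : ℕ) : (levelStab H n).FiniteIndex := by
  have : levelStab H n = ((levelPerm n).comp H.subtype).ker := by
    ext g
    change (∀ v : List Bool, v.length = n → _) ↔ _
    rw [MonoidHom.mem_ker, MonoidHom.comp_apply, ← MonoidHom.mem_ker]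
    exact mem_levelFix.symm
  rw [this]
  infer_instance

theorem infinite_of_isLevelTransitive {H : Subgroup TreeAut} (h : IsLevelTransitive H) :
    Infinite H := by
  by_contra hfin
  rw [not_infinite_iff_finite] at hfin
  have := Fintype.ofFinite H
  have hsurj : Function.Surjective fun g : H =>
      (levelPerm (Fintype.card H) g (List.Vector.replicate _ false)) := fun v => by
    obtain ⟨g, hg, e⟩ := h (List.replicate (Fintype.card H) false) v.1 (by simp [v.2])
    exact ⟨⟨g, hg⟩, Subtype.ext e⟩
  have := Fintype.card_le_of_surjective _ hsurj
  rw [card_vector, Fintype.card_bool] at this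
  exact absurd this (not_le.2 Nat.lt_two_pow_self)

theorem exists_levelStab_le_of_normal {ω : ℕ → Fin 3} (hω : ∀ n, ∃ m ≥ n, ω (m + 1) ≠ ω m)
    {L : Subgroup (G ω)} (hL : L.Normal) (hne : L ≠ ⊥) : ∃ n, levelStab (G ω) n ≤ L := by
  obtain ⟨n, hn⟩ := exists_levelFix_le_of_normalizes hω (K := L.map (G ω).subtype)
    (by
      rintro g hg _ ⟨k, hk, rfl⟩
      exact ⟨⟨g, hg⟩ * k * ⟨g, hg⟩⁻¹, hL.conj_mem k hk _, rfl⟩)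
    (by rwa [Ne, Subgroup.map_eq_bot_iff_of_injective _ (G ω).subtype_injective])
  exact ⟨n, map_subtype_levelStab_le hn le_rfl⟩

theorem isJustInfinite_G {ω : ℕ → Fin 3} (hω : ∀ n, ∃ m ≥ n, ω (m + 1) ≠ ω m) :
    IsJustInfinite (G ω) := by
  refine ⟨infinite_of_isLevelTransitive (isLevelTransitive_G ω), fun L hL hne => ?_⟩
  obtain ⟨n, hn⟩ := exists_levelStab_le_of_normal hω hL hne
  have := finiteIndex_levelStab (G ω) n
  exact Subgroup.finiteIndex_of_le hn

theorem not_finiteIndex_bot (Γ : Type*) [Group Γ] [Infinite Γ] :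
    ¬ (⊥ : Subgroup Γ).FiniteIndex := fun h => h.index_ne_zero (by simp)

theorem hasCSP_G {ω : ℕ → Fin 3} (hω : ∀ n, ∃ m ≥ n, ω (m + 1) ≠ ω m) : HasCSP (G ω) := by
  intro K hK
  have := infinite_of_isLevelTransitive (isLevelTransitive_G ω)
  have hne : K.normalCore ≠ ⊥ := fun h => not_finiteIndex_bot (G ω) (h ▸ inferInstance)
  obtain ⟨n, hn⟩ := exists_levelStab_le_of_normal hω K.normalCore_normal hne
  exact ⟨n, hn.trans K.normalCore_le⟩

theorem isBranch_G {ω : ℕ → Fin 3} (hω : ∀ n, ∃ m ≥ n, ω (m + 1) ≠ ω m) : IsBranch (G ω) := by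
  refine ⟨isLevelTransitive_G ω, fun n => ?_⟩
  -- sections in a deep level stabiliser can be put below any vertex of level `n`
  obtain ⟨m, hm⟩ : ∃ m, ∀ u : List Bool, u.length = n → ∀ y ∈ G (shift n ω) ⊓ levelFix m,
      put u y ∈ G ω := by
    rcases n with _ | n
    · refine ⟨0, fun u hu y hy => ?_⟩
      rw [List.length_eq_zero_iff.1 hu]
      exact hy.1
    · obtain ⟨m, hm⟩ := exists_levelFix_le_M (not_const_shift hω (n + 1)) (ω n)
      exact ⟨m, fun u hu y hy => put_mem_G hu (hm hy)⟩
  have h : G ω ⊓ levelFix (m + n) ≤ (ristLevel (G ω) n).map (G ω).subtype := by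
    refine fun g hg => mem_of_forall_put_mem n m (fun u hu y hy => ?_) hg.1 hg.2
    have hr : (⟨put u y, hm u hu y hy⟩ : G ω) ∈ rist (G ω) u := fun _ hv =>
      put_apply_of_not_prefix hv y
    exact Subgroup.mem_map_of_mem (G ω).subtype (Subgroup.mem_iSup_of_mem
      (S := fun u : {u : List Bool // u.length = n} => rist (G ω) u) ⟨u, hu⟩ hr)
  have := finiteIndex_levelStab (G ω) (m + n)
  exact Subgroup.finiteIndex_of_le (map_subtype_levelStab_le h le_rfl)

/-! ### Eventually constant sequences -/

theorem dir_eq_one_of_const {k : Fin 3} {ω : ℕ → Fin 3} (hω : ∀ n, ω n = k) : dir k ω = 1 := by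
  ext1 v
  change dirFun k ω v = v
  induction v generalizing ω with
  | nil => rfl
  | cons x w ih => cases x <;> simp [dirFun, hω, ih]

/-- For a constant sequence `G ω` is an infinite dihedral group, whose elements are powers of the
product of `a` and the other generator, up to a factor `a`. -/
theorem eq_zpow_of_const {ω : ℕ → Fin 3} (hω : ∀ n, ω n = ω 0) {j : Fin 3} (hj : ω 0 ≠ j)
    {g : TreeAut} (hg : g ∈ G ω) :
    ∃ i : ℤ, g = (a * dir j ω) ^ i ∨ g = (a * dir j ω) ^ i * a := by
  have hN : ∀ n ∈ N (shift 1 ω) (ω 0), n = 1 := by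
    have hd : dir (ω 0) (shift 1 ω) = 1 := dir_eq_one_of_const fun n => hω (n + 1)
    have hM : M (shift 1 ω) (ω 0) ≤ ⊥ := by
      refine conjClosure_le (fun g _ k hk => ?_) (by simp [hd])
      rw [Subgroup.mem_bot] at hk ⊢
      simp [hk]
    rintro n (hn | hn)
    · exact Subgroup.mem_bot.1 (hM hn)
    · simpa [hd] using Subgroup.mem_bot.1 (hM hn)
  obtain ⟨n₀, h₀, n₁, h₁, i, h⟩ := exists_eq_pair_mul_zpow hj hg
  rw [hN _ h₀, hN _ h₁, pair_one_one, one_mul] at h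
  exact ⟨i, h⟩

/-- If `G ω` is dihedral, no nontrivial element of it is supported below a vertex of the first
level: the sections of the square of the rotation `r = a * dir j ω` are `r⁻¹` and `r`. -/
theorem eq_one_of_put_single_mem {ω : ℕ → Fin 3} (hω : ∀ n, ω n = ω 0) {x : Bool} {g : TreeAut}
    (hg : put [x] g ∈ G ω) : g = 1 := by
  obtain ⟨j, hj⟩ : ∃ j, ω 0 ≠ j := (exists_ne (ω 0)).imp fun _ h => h.symm
  have hg' : pair 1 g ∈ G ω := (normalizes_self (G ω)).put_swap hg true
  obtain ⟨i, hi⟩ := eq_zpow_of_const hω hj hg'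
  have hs : shift 1 ω = ω := funext fun n => (hω (n + 1)).trans (hω n).symm
  have hy : dir j ω = pair a (dir j ω) := by
    conv_lhs => rw [dir_eq_of_ne hj, hs]
  set y := dir j ω with hyd
  have hyy : y * y = 1 := dir_mul_self j ω
  have hr : ∀ k : ℤ, (a * y) ^ (2 * k) = pair ((a * y) ^ (-k)) ((a * y) ^ k) := fun k => by
    have : (a * y) ^ (2 : ℤ) = pair (a * y)⁻¹ (a * y) := by
      rw [zpow_two]
      nth_rw 1 2 [hy]
      simp [mul_assoc, hyd]
    rw [zpow_mul, this, pair_zpow, inv_zpow, zpow_neg]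
  have hr' : ∀ k : ℤ, (a * y) ^ (2 * k + 1) =
      a * pair ((a * y) ^ k * a) ((a * y) ^ (-k) * y) := fun k => by
    rw [zpow_add, zpow_one, hr]
    nth_rw 3 [hy]
    rw [pair_mul_a_mul, pair_mul]
  rcases Int.even_or_odd' i with ⟨k, rfl | rfl⟩ <;> rcases hi with hi | hi
  · rw [hr, pair_inj] at hi
    rw [hi.2, ← inv_inv ((a * y) ^ k), ← zpow_neg, ← hi.1, inv_one]
  · rw [hr, pair_mul_a] at hi
    exact absurd hi.symm (a_mul_pair_ne _ _ _ _)
  · rw [hr'] at hi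
    exact absurd hi.symm (a_mul_pair_ne _ _ _ _)
  · -- the section at `0` shows that `y` is a rotation, which is impossible
    rw [hr', mul_assoc, pair_mul_a, a_mul_a_mul, pair_inj] at hi
    have hyk : (a * y) ^ k = y := by
      have := hi.1
      rw [zpow_neg] at this
      exact (inv_mul_eq_one.1 this.symm)
    rcases Int.even_or_odd' k with ⟨m, rfl | rfl⟩
    · rw [hr, hy, pair_inj, ← hy] at hyk
      have h1 := hyk.1
      rw [zpow_neg, hyk.2, hyd, dir_inv, ← hyd] at h1
      exact absurd (h1.symm.trans hy) (a_ne_pair _ _)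
    · rw [hr', hy] at hyk
      exact absurd hyk (a_mul_pair_ne _ _ _ _)

theorem exists_put_of_fix {ω : ℕ → Fin 3} {x : Bool} {u : List Bool} {g : TreeAut} (hg : g ∈ G ω)
    (hgu : ∀ v, ¬ x :: u <+: v → g v = v) : ∃ f ∈ G (shift 1 ω), g = put [x] f := by
  have hx : ∀ v, g ((!x) :: v) = (!x) :: v := fun v => hgu _ (by simp [List.cons_prefix_cons])
  obtain ⟨g₀, h₀, g₁, h₁, rfl | rfl⟩ := exists_pair_of_mem hg
  · cases x
    · exact ⟨g₀, h₀, pair_inj.2 ⟨rfl, RelIso.ext fun v => by simpa using hx v⟩⟩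
    · exact ⟨g₁, h₁, pair_inj.2 ⟨RelIso.ext fun v => by simpa using hx v, rfl⟩⟩
  · have := hx []
    cases x <;> simp at this

/-- If `ω` is constant from the position `n` on, the rigid stabilisers of the vertices of level
`n + 1` are trivial. -/
theorem eq_one_of_fix {ω : ℕ → Fin 3} {n : ℕ} (hω : ∀ m, ω (m + n) = ω n) {u : List Bool}
    (hu : u.length = n + 1) {g : TreeAut} (hg : g ∈ G ω) (hgu : ∀ v, ¬ u <+: v → g v = v) :
    g = 1 := by
  induction n generalizing ω u g with
  | zero =>
    obtain ⟨x, rfl⟩ := List.length_eq_one_iff.1 hu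
    obtain ⟨f, -, rfl⟩ := exists_put_of_fix hg hgu
    rw [eq_one_of_put_single_mem hω hg, map_one]
  | succ n ih =>
    obtain ⟨x, u, rfl⟩ := List.exists_cons_of_length_eq_add_one hu
    obtain ⟨f, hf, rfl⟩ := exists_put_of_fix hg hgu
    rw [ih (ω := shift 1 ω) (u := u) (fun m => hω m) (by simpa using hu) hf fun v hv => ?_, map_one]
    have := hgu (x :: v) (by simpa [List.cons_prefix_cons] using hv)
    cases x <;> simpa using this

theorem not_isBranch_G {ω : ℕ → Fin 3} {n : ℕ} (hω : ∀ m, ω (m + n) = ω n) :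
    ¬ IsBranch (G ω) := by
  intro h
  have := infinite_of_isLevelTransitive h.1
  have hbot : ristLevel (G ω) (n + 1) = ⊥ := by
    rw [ristLevel, iSup_eq_bot]
    rintro ⟨u, hu⟩
    rw [Subgroup.eq_bot_iff_forall]
    exact fun g hg => Subtype.ext (eq_one_of_fix hω hu g.2 fun v hv => hg v hv)
  exact not_finiteIndex_bot (G ω) (hbot ▸ h.2 (n + 1))

end Grigorchuk

theorem mainTheorem2 (ω : ℕ → Fin 3) :
    (Grigorchuk.IsBranch (Grigorchuk.G ω) ↔ ¬ Filter.EventuallyConst ω Filter.atTop) ∧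
    (Grigorchuk.IsBranch (Grigorchuk.G ω) →
      Grigorchuk.HasCSP (Grigorchuk.G ω) ∧ Grigorchuk.IsJustInfinite (Grigorchuk.G ω)) := by
  by_cases h : Filter.EventuallyConst ω Filter.atTop
  · obtain ⟨n, hn⟩ := Filter.eventuallyConst_atTop.1 h
    have := Grigorchuk.not_isBranch_G (ω := ω) (n := n) fun m => hn _ (Nat.le_add_left n m)
    exact ⟨iff_of_false this (not_not_intro h), fun hb => absurd hb this⟩
  · have hω : ∀ n, ∃ m ≥ n, ω (m + 1) ≠ ω m := by
      by_contra! hc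
      obtain ⟨n, hn⟩ := hc
      refine h (Filter.eventuallyConst_atTop.2 ⟨n, fun m hm => ?_⟩)
      induction m, hm using Nat.le_induction with
      | base => rfl
      | succ m hm ih => rw [hn m hm, ih]
    exact ⟨iff_of_true (Grigorchuk.isBranch_G hω) h,
      fun _ => ⟨Grigorchuk.hasCSP_G hω, Grigorchuk.isJustInfinite_G hω⟩⟩
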